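/- Let $s$ and $d$ be coprime positive integers and let $p\ge 2$ be an integer. Let $\mathcal{SC}_{(s,s+d,\dots,s+pd)}$ be the set of self-conjugate partitions (the empty one included) none of whose boxes has hook length $s, s+d,\dots,s+pd$. Let $\mathcal F(m,t)$ be the set of paths from $(0,0)$ to $(m,t)$ with steps $U=(1,1)$, $D=(1,-1)$ and $F=(1,0)$. For a self-conjugate partition $\lambda$ let $MD(\lambda)$ be the set of hook lengths of the boxes on its main diagonal. Let $a=-s$ if $s$ is odd and $a=-(s+d)$ if $s$ is even. For $i\in\mathbb Z$ and $0\le j\le\lfloor (s+d-1)/2\rfloor$ give position $(i,j)$ the label $a+2(s+d)i+2dj$; the position carries a bead if the absolute value of its label lies in $MD(\lambda)$, and is a spacer otherwise. Define $f(j)$ to be the largest $i$ such that $(i,j)$ carries a bead, if some position in column $j$ with a positive label carries a bead, and otherwise the largest $i$ such that $(i,j)$ is a spacer with a negative label. If $d$ is odd, set in addition $f(\lfloor s/2\rfloor+(d+1)/2)=-(d+1)/2$. Let $\phi_{(s+d,d)}(\lambda)$ be the path that starts at $(0,0)$ and whose $j$-th step is $(1,f(j)-f(j-1))$ for $j=1,\dots,\lfloor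 s/2\rfloor+\lceil d/2\rceil$. **Theorem.** The map $\phi_{(s+d,d)}$ is a bijection from $\mathcal{SC}_{(s,s+d,\dots,s+pd)}$ onto the set of paths $P\in\mathcal F(\lfloor s/2\rfloor+\lceil d/2\rceil,\,-\lceil d/2\rceil)$ such that 1. if $p\ge 3$, then $P$ has no $UF^iU$ as a consecutive subpath for $i=0,1,\dots,p-3$; 2. $P$ does not start with $F^jU$, and 3. $P$ does not end with $UF^k$, for all $j$ and $k$ in the following ranges: (a) $s$ odd, $d$ even: $j=0,\dots,\lfloor (p-4)/2\rfloor$ if $p\ge4$ (no condition on the start if $p<4$), and $k=0,\dots,\lfloor (p-3)/2\rfloor$ if $p\ge 3$ (no condition on the end if $p<3$); (b) $s$ odd, $d$ odd: $j=0,\dots,\lfloor (p-4)/2\rfloor$ if $p\ge4$ (no condition on the start if $p<4$), and $k=0,\dots,p-2$; (c) $s$ even, $d$ odd: $j=0,\dots,\lfloor (p-3)/2\rfloor$ if $p\ge3$ (no condition on the start if $p<3$), and $k=0,\dots,p-2$. -/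

import Mathlib

namespace SelfConjCore

/-! ### Core partitions

Partitions are represented by their Young diagrams, with rows and columns indexed from `0`. -/

/-- The hook length of the box `c = (i, j)`: the number of boxes of row `i` weakly to the right of
`c`, plus the number of boxes of column `j` strictly below `c`. -/
def hookLength (μ : YoungDiagram) (c : ℕ × ℕ) : ℕ :=
  (μ.rowLen c.1 - c.2) + (μ.colLen c.2 - (c.1 + 1))

/-- `μ` is an `s`-core: no box of `μ` has hook length `s`. -/
def IsCore (s : ℕ) (μ : YoungDiagram) : Prop :=
  ∀ c ∈ μ, hookLength μ c ≠ s

/-- The set of self-conjugate `(s, s+d, …, s+pd)`-core partitions. -/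
def SC (s d p : ℕ) : Set YoungDiagram :=
  {μ | μ.transpose = μ ∧ ∀ i ≤ p, IsCore (s + i * d) μ}

/-- `MD(μ)`: the set of hook lengths of the boxes of `μ` on the main diagonal. -/
def MD (μ : YoungDiagram) : Set ℕ :=
  {h | ∃ i, (i, i) ∈ μ ∧ hookLength μ (i, i) = h}

/-! ### The `(s+d, d; a)`-abacus -/

/-- The integer `a = a(s, d)`: `-a` is the smallest odd number among `s` and `s + d`
(for coprime `s`, `d`, at least one of the two is odd). -/
def abacusStart (s d : ℕ) : ℤ :=
  if Odd s then -(s : ℤ) else -((s : ℤ) + d)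

/-- The label `a + 2(s+d)i + 2dj` of the position in row `i` and column `j`. -/
def label (s d : ℕ) (i : ℤ) (j : ℕ) : ℤ :=
  abacusStart s d + 2 * ((s : ℤ) + d) * i + 2 * d * j

/-- A bead is placed on position `(i, j)` when the absolute value of its label lies in `MD(μ)`;
otherwise the position is a spacer. -/
def IsBead (s d : ℕ) (μ : YoungDiagram) (i : ℤ) (j : ℕ) : Prop :=
  (label s d i j).natAbs ∈ MD μ

open Classical in
/-- The `(s+d, d; a)`-abacus function of `μ`. If column `j` has a bead with a positive label, it is
the largest row that has a bead in column `j`; otherwise it is the largest row `i` such that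
`(i, j)` is a spacer with a negative label. As `MD(μ)` is finite, each supremum is taken over a
nonempty set of integers that is bounded above, so it is a maximum. -/
noncomputable def abacusFun (s d : ℕ) (μ : YoungDiagram) (j : ℕ) : ℤ :=
  if ∃ i : ℤ, 0 < label s d i j ∧ IsBead s d μ i j then
    sSup {i : ℤ | IsBead s d μ i j}
  else
    sSup {i : ℤ | label s d i j < 0 ∧ ¬ IsBead s d μ i j}

/-! ### Free rational Motzkin paths

A lattice path starting at `(0, 0)` is represented by the list of its steps. -/

/-- The up step. -/
def U : ℤ × ℤ := (1, 1)

/-- The flat step. -/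
def F : ℤ × ℤ := (1, 0)

/-- The down step. -/
def D : ℤ × ℤ := (1, -1)

/-- The free rational Motzkin paths of type `(m, t)`: paths from `(0, 0)` to `(m, t)` all of whose
steps are `U`, `D` or `F`. -/
def FreeMotzkin (m t : ℤ) : Set (List (ℤ × ℤ)) :=
  {P | (∀ x ∈ P, x = U ∨ x = D ∨ x = F) ∧ P.sum = (m, t)}

/-- `P` has the word `U Fⁱ U` as a consecutive subpath. -/
def ContainsUFU (i : ℕ) (P : List (ℤ × ℤ)) : Prop :=
  (U :: (List.replicate i F ++ [U])) <:+: P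

/-- `P` starts with `Fʲ U`. -/
def StartsFU (j : ℕ) (P : List (ℤ × ℤ)) : Prop :=
  (List.replicate j F ++ [U]) <+: P

/-- `P` ends with `U Fᵏ`. -/
def EndsUF (k : ℕ) (P : List (ℤ × ℤ)) : Prop :=
  (U :: List.replicate k F) <:+ P

/-- The heights of the path of `μ`: the abacus function, which has the columns
`0, …, ⌊(s+d-1)/2⌋`, extended by the value `-(d+1)/2` at `⌊s/2⌋ + (d+1)/2 = ⌊(s+d-1)/2⌋ + 1`
when `d` is odd. -/
noncomputable def height (s d : ℕ) (μ : YoungDiagram) (j : ℕ) : ℤ :=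
  if Odd d ∧ j = s / 2 + (d + 1) / 2 then -(((d + 1) / 2 : ℕ) : ℤ) else abacusFun s d μ j

/-- The mapping `φ_{(s+d,d)}`: the `j`-th step of the path of `μ` is `(1, f(j) - f(j-1))` for
`j = 1, …, ⌊s/2⌋ + ⌈d/2⌉`. Here `⌈d/2⌉` is written as `(d + 1) / 2`, and the index is shifted
by one. -/
noncomputable def phi (s d : ℕ) (μ : YoungDiagram) : List (ℤ × ℤ) :=
  (List.range (s / 2 + (d + 1) / 2)).map fun j => (1, height s d μ (j + 1) - height s d μ j)

/-- The restrictions on the paths that correspond to `(s, s+d, …, s+pd)`-cores. Divisions are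
rounded down, and each subtraction is guarded by a lower bound on `p`. -/
def Restricted (s d p : ℕ) (P : List (ℤ × ℤ)) : Prop :=
  (3 ≤ p → ∀ i ≤ p - 3, ¬ ContainsUFU i P) ∧
  (Odd s → Even d →
    (4 ≤ p → ∀ j ≤ (p - 4) / 2, ¬ StartsFU j P) ∧
    (3 ≤ p → ∀ k ≤ (p - 3) / 2, ¬ EndsUF k P)) ∧
  (Odd s → Odd d →
    (4 ≤ p → ∀ j ≤ (p - 4) / 2, ¬ StartsFU j P) ∧
    (2 ≤ p → ∀ k ≤ p - 2, ¬ EndsUF k P)) ∧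
  (Even s → Odd d →
    (3 ≤ p → ∀ j ≤ (p - 3) / 2, ¬ StartsFU j P) ∧
    (2 ≤ p → ∀ k ≤ p - 2, ¬ EndsUF k P))

end SelfConjCore

/-!
Encode a partition `μ` by its beta set `{μ_i - i - 1}`. A box of hook length `t` is a pair `b`,
`b - t` with `b` in the beta set and `b - t` outside it, so `μ` is a `t`-core exactly if its beta
set is closed under subtracting `t` (`isCore_iff`). Conjugation turns the beta set into the
complement of its mirror image under `z ↦ -1 - z`, and every set that is bounded above and equal to
this complement is the beta set of a unique self-conjugate partition (`exists_betaSet_eq`). For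
self-conjugate `μ`, the diagonal hook lengths are the numbers `2 * b + 1` with `b ≥ 0` in the beta
set. Hence the beads with a positive label and the spacers with a negative label are together the
positions whose label is `2 * b + 1` for some `b` in the beta set.

Allow all integers as columns of the abacus. Closure under subtracting `s + d` says that in every
column `j` these positions are the rows `i ≤ g j`, and `g` restricts to the abacus function
(`Represents.abacusFun_eq`). In terms of `g`:

* labels repeat: `g (j + (s + d)) = g j - d`;
* self-conjugacy: `g (e - j) = -g j`, with `e = -1` for odd `s` and `e = 0` for even `s`;
* core property: closure under subtracting `s + k * d` for all `k ≤ p` says that `g v - g u ≤ 1`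
  whenever `-1 ≤ v - u ≤ p - 1`.

So self-conjugate cores correspond to such functions `g`. By the first two properties `g` is odd
about `(e / 2, 0)` and about `((e + s + d) / 2, -d / 2)`, and it is determined by its values at the
integers between these two centres (`IsFolded.eq_of_eqOn`), where any values that respect the
centres can be prescribed (`isFolded_foldExtend`). These values are the heights of the path; for
odd `d` the second centre is a half-integer, and the last step of the path replaces the step across
it.

It remains to fold the core property. A window `[u, v]` between the two centres gives the condition
that the path does not rise by more than `1` in at most `p - 1` steps; a shortest violation is a
word `U Fⁱ U`. A window that is symmetric about the first centre gives `h x ≤ 0` for small `x`, and its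
first violation is an initial word `Fʲ U`; the second centre gives in the same way the condition on
the end. The remaining windows follow from these (`IsFolded.sub_le_one`).
-/

namespace SelfConjCore

/-! ### Beta sets of partitions -/

/-- The beta set of `μ`: the numbers `μ_i - i - 1`, where `μ_i` is the length of row `i ≥ 0`. Rows
of length `0` are included, so the set contains all small enough integers. -/
def betaSet (μ : YoungDiagram) : Set ℤ :=
  {x | ∃ i : ℕ, x = (μ.rowLen i : ℤ) - i - 1}

theorem lt_rowLen_iff_lt_colLen (μ : YoungDiagram) (i j : ℕ) : j < μ.rowLen i ↔ i < μ.colLen j := by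
  rw [← YoungDiagram.mem_iff_lt_rowLen, YoungDiagram.mem_iff_lt_colLen]

theorem mem_betaSet_or (μ : YoungDiagram) (z : ℤ) :
    z ∈ betaSet μ ∨ ∃ j : ℕ, z = (j : ℤ) - μ.colLen j := by
  have hex : ∃ i : ℕ, (μ.rowLen i : ℤ) - i - 1 ≤ z := by
    refine ⟨μ.rowLen 0 + z.natAbs, ?_⟩
    have := μ.rowLen_anti 0 (μ.rowLen 0 + z.natAbs) (Nat.zero_le _)
    omega
  classical
  obtain ⟨i, hi, hmin⟩ : ∃ i : ℕ, (μ.rowLen i : ℤ) - i - 1 ≤ z ∧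
      ∀ k < i, z < (μ.rowLen k : ℤ) - k - 1 :=
    ⟨Nat.find hex, Nat.find_spec hex, fun k hk => not_le.1 (Nat.find_min hex hk)⟩
  rcases hi.eq_or_lt with h | h
  · exact Or.inl ⟨i, h.symm⟩
  right
  -- the column `z + i` has length exactly `i`
  obtain ⟨j, hj⟩ := Int.eq_ofNat_of_zero_le (show 0 ≤ z + i by omega)
  refine ⟨j, ?_⟩
  have h1 : ¬ i < μ.colLen j := by
    rw [← lt_rowLen_iff_lt_colLen]; omega
  rcases Nat.eq_zero_or_pos i with h0 | h0
  · omega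
  · have h2 := hmin (i - 1) (by omega)
    have h3 : i - 1 < μ.colLen j := by
      rw [← lt_rowLen_iff_lt_colLen]; omega
    omega

/-- The complement of the beta set is given by the columns. -/
theorem notMem_betaSet_iff (μ : YoungDiagram) (z : ℤ) :
    z ∉ betaSet μ ↔ ∃ j : ℕ, z = (j : ℤ) - μ.colLen j := by
  refine ⟨fun h => (mem_betaSet_or μ z).resolve_left h, ?_⟩
  rintro ⟨j, rfl⟩ ⟨i, hi⟩
  have := lt_rowLen_iff_lt_colLen μ i j
  omega

/-- The box `(i, j)` has hook length `b - z`, where `b = μ_i - i - 1` lies in the beta set and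
`z = j - μ'_j` in its complement; if `(i, j)` is not a box, then `b - z < 0`. -/
theorem isCore_iff (μ : YoungDiagram) {t : ℕ} (ht : 0 < t) :
    IsCore t μ ↔ ∀ b ∈ betaSet μ, b - t ∈ betaSet μ := by
  constructor
  · rintro h b ⟨i, rfl⟩
    by_contra hb
    obtain ⟨j, hj⟩ := (notMem_betaSet_iff _ _).1 hb
    have h1 := lt_rowLen_iff_lt_colLen μ i j
    have h2 : j < μ.rowLen i := by omega
    refine h (i, j) (YoungDiagram.mem_iff_lt_rowLen.2 h2) ?_
    simp only [hookLength]
    omega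
  · rintro h ⟨i, j⟩ hc heq
    have h2 := YoungDiagram.mem_iff_lt_rowLen.1 hc
    have h1 := (lt_rowLen_iff_lt_colLen μ i j).1 h2
    refine (notMem_betaSet_iff μ ((μ.rowLen i : ℤ) - i - 1 - t)).2 ⟨j, ?_⟩ (h _ ⟨i, rfl⟩)
    simp only [hookLength] at heq
    omega

theorem mem_betaSet_transpose (μ : YoungDiagram) (z : ℤ) :
    z ∈ betaSet μ.transpose ↔ -1 - z ∉ betaSet μ := by
  rw [notMem_betaSet_iff]
  refine exists_congr fun j => ?_
  rw [YoungDiagram.rowLen_transpose]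
  omega

theorem mem_betaSet_iff_of_transpose_eq {μ : YoungDiagram} (hμ : μ.transpose = μ) (z : ℤ) :
    z ∈ betaSet μ ↔ -1 - z ∉ betaSet μ := by
  rw [← mem_betaSet_transpose, hμ]

theorem mem_MD_iff {μ : YoungDiagram} (hμ : μ.transpose = μ) (h : ℕ) :
    h ∈ MD μ ↔ ∃ b ∈ betaSet μ, 0 ≤ b ∧ (h : ℤ) = 2 * b + 1 := by
  have hc : ∀ i, μ.colLen i = μ.rowLen i := fun i => by
    rw [← YoungDiagram.rowLen_transpose, hμ]
  constructor
  · rintro ⟨i, hi, rfl⟩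
    have := YoungDiagram.mem_iff_lt_rowLen.1 hi
    refine ⟨_, ⟨i, rfl⟩, by omega, ?_⟩
    simp only [hookLength, hc]
    omega
  · rintro ⟨b, ⟨i, rfl⟩, h0, hb⟩
    refine ⟨i, YoungDiagram.mem_iff_lt_rowLen.2 (by omega), ?_⟩
    simp only [hookLength, hc]
    omega

theorem betaSet_bddAbove (μ : YoungDiagram) : ∀ b ∈ betaSet μ, b < μ.rowLen 0 := by
  rintro b ⟨i, rfl⟩
  have := μ.rowLen_anti 0 i (Nat.zero_le _)
  omega

/-- The beta set is enumerated strictly decreasingly by the rows, so it determines them. -/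
theorem betaSet_injective : Function.Injective betaSet := by
  intro μ ν h
  have hmono : ∀ κ : YoungDiagram, StrictMono fun i : ℕ => (i : ℤ) - κ.rowLen i := fun κ =>
    strictMono_nat_of_lt_succ fun i => by
      have := κ.rowLen_anti i (i + 1) (Nat.le_succ _)
      push_cast
      omega
  have hrange : ∀ κ : YoungDiagram,
      Set.range (fun i : ℕ => (i : ℤ) - κ.rowLen i) = {x | -1 - x ∈ betaSet κ} := fun κ => by
    ext x
    refine exists_congr fun i => ?_
    change (i : ℤ) - κ.rowLen i = x ↔ -1 - x = (κ.rowLen i : ℤ) - i - 1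
    omega
  have := (hmono μ).range_inj (hmono ν) |>.1 (by rw [hrange, hrange, h])
  ext ⟨i, j⟩
  rw [YoungDiagram.mem_cells, YoungDiagram.mem_cells, YoungDiagram.mem_iff_lt_rowLen,
    YoungDiagram.mem_iff_lt_rowLen]
  have : (i : ℤ) - μ.rowLen i = i - ν.rowLen i := congrFun this i
  omega

/-- An antitone, eventually vanishing sequence is the sequence of row lengths of a Young diagram. -/
theorem exists_rowLen_eq (l : ℕ → ℕ) (hl : Antitone l) (n : ℕ) (hn : ∀ i, n ≤ i → l i = 0) :
    ∃ μ : YoungDiagram, ∀ i, μ.rowLen i = l i := by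
  let μ : YoungDiagram :=
    { cells := (Finset.range n ×ˢ Finset.range (l 0)).filter fun c => c.2 < l c.1
      isLowerSet := by
        rintro ⟨i, j⟩ ⟨i', j'⟩ ⟨h1, h2⟩ hc
        simp only [Finset.coe_filter, Finset.mem_product, Finset.mem_range, Set.mem_ofPred_eq] at *
        have := hl h1
        omega }
  have hμ : ∀ i j, (i, j) ∈ μ ↔ j < l i := by
    intro i j
    change (i, j) ∈ Finset.filter _ _ ↔ _
    simp only [Finset.mem_filter, Finset.mem_product, Finset.mem_range]
    refine ⟨fun h => h.2, fun h => ⟨⟨?_, ?_⟩, h⟩⟩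
    · by_contra hni
      have := hn i (by omega)
      omega
    · exact h.trans_le (hl (Nat.zero_le i))
  refine ⟨μ, fun i => ?_⟩
  have h1 := fun j => (YoungDiagram.mem_iff_lt_rowLen (μ := μ) (i := i) (j := j)).symm.trans (hμ i j)
  have h2 := h1 (l i)
  have h3 := h1 (μ.rowLen i)
  omega

theorem count_eq_of_symm (p : ℕ → Prop) [DecidablePred p] (n : ℕ)
    (hp : ∀ k < 2 * n, p k ↔ ¬ p (2 * n - 1 - k)) : Nat.count p (2 * n) = n := by
  have h1 := Finset.card_filter_add_card_filter_not (s := Finset.range (2 * n)) p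
  have h2 : ((Finset.range (2 * n)).filter p).card
      = ((Finset.range (2 * n)).filter fun k => ¬ p k).card := by
    refine Finset.card_bij' (fun k _ => 2 * n - 1 - k) (fun k _ => 2 * n - 1 - k) ?_ ?_ ?_ ?_
    · intro k hk
      simp only [Finset.mem_filter, Finset.mem_range] at hk ⊢
      exact ⟨by omega, (hp k hk.1).1 hk.2⟩
    · intro k hk
      simp only [Finset.mem_filter, Finset.mem_range] at hk ⊢
      refine ⟨by omega, ?_⟩
      have := hp k hk.1
      tauto
    · intro k hk
      simp only [Finset.mem_filter, Finset.mem_range] at hk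
      omega
    · intro k hk
      simp only [Finset.mem_filter, Finset.mem_range] at hk
      omega
  rw [Nat.count_eq_card_filter_range]
  rw [← h2, Finset.card_range] at h1
  change (Finset.filter p _).card = n
  omega

/-- A set that is bounded above and exchanged with its complement by `z ↦ -1 - z` is the beta set of
a self-conjugate partition: the row lengths are read off from its decreasing enumeration, and the
symmetry ensures that they are eventually `0`. -/
theorem exists_betaSet_eq {B : Set ℤ} (hB : ∀ z, z ∈ B ↔ -1 - z ∉ B) {n : ℕ}
    (hn : ∀ z ∈ B, z < n) : ∃ μ : YoungDiagram, μ.transpose = μ ∧ betaSet μ = B := by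
  classical
  have hneg : ∀ z : ℤ, z < -n → z ∈ B := fun z hz => (hB z).2 fun h => by
    have := hn _ h
    omega
  -- `B` is enumerated decreasingly, starting from its upper bound `n - 1`
  let p : ℕ → Prop := fun k => (n : ℤ) - 1 - k ∈ B
  have hp : ∀ k, 2 * n ≤ k → p k := fun k hk => hneg _ (by omega)
  have hcount : ∀ i, Nat.count p (2 * n + i) = n + i := by
    intro i
    induction i with
    | zero =>
      refine count_eq_of_symm p n fun k hk => (hB _).trans (not_congr ?_)
      change _ ↔ (n : ℤ) - 1 - ((2 * n - 1 - k : ℕ) : ℤ) ∈ B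
      rw [show (n : ℤ) - 1 - ((2 * n - 1 - k : ℕ) : ℤ) = -1 - ((n : ℤ) - 1 - k) by omega]
    | succ i ih =>
      rw [← add_assoc, Nat.count_succ, ih, if_pos (hp _ (by omega)), add_assoc]
  have hinf : (Set.ofPred p).Infinite := Set.infinite_of_forall_exists_gt fun a =>
    ⟨2 * n + a + 1, hp _ (by omega), by omega⟩
  have hlarge : ∀ i, Nat.nth p (n + i) = 2 * n + i := fun i => by
    rw [← hcount i]
    exact Nat.nth_count (hp _ (by omega))
  have hmono : StrictMono (Nat.nth p) := Nat.nth_strictMono hinf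
  have hgap : ∀ i k, Nat.nth p i + k ≤ Nat.nth p (i + k) := by
    intro i k
    induction k with
    | zero => simp
    | succ k ih =>
      have := hmono (show i + k < i + (k + 1) by omega)
      omega
  have hle : ∀ i, Nat.nth p i ≤ n + i := by
    intro i
    have h1 := hgap i n
    have h2 := hlarge i
    rw [add_comm n i] at h2
    omega
  obtain ⟨μ, hμ⟩ := exists_rowLen_eq (fun i => n + i - Nat.nth p i)
    (antitone_nat_of_succ_le fun i => by
      have := hgap i 1
      omega) n (fun i hi => by
      have := hlarge (i - n)
      rw [show n + (i - n) = i by omega] at this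
      omega)
  have hbeta : betaSet μ = B := by
    ext z
    constructor
    · rintro ⟨i, rfl⟩
      have h1 : p (Nat.nth p i) := Nat.nth_mem_of_infinite hinf i
      have h2 := hle i
      rw [hμ]
      have h3 : (((n + i - Nat.nth p i : ℕ) : ℤ)) - i - 1 = n - 1 - Nat.nth p i := by omega
      rw [h3]
      exact h1
    · intro hz
      have h0 := hn z hz
      obtain ⟨k, hk⟩ := Int.eq_ofNat_of_zero_le (show 0 ≤ (n : ℤ) - 1 - z by omega)
      have hpk : p k := by
        change (n : ℤ) - 1 - k ∈ B
        rwa [show (n : ℤ) - 1 - k = z by omega]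
      refine ⟨Nat.count p k, ?_⟩
      have h1 := hle (Nat.count p k)
      rw [hμ]
      simp only [Nat.nth_count hpk] at h1 ⊢
      omega
  refine ⟨μ, betaSet_injective ?_, hbeta⟩
  ext z
  rw [mem_betaSet_transpose, hbeta, ← hB]

/-! ### Functions that are odd about two centres -/

/-- The symmetries of the column function of the abacus, where `N = s + d`: the translation by `N`
lowers the function by `d`, and the function is odd about `e / 2`. -/
structure IsFolded (N d e : ℤ) (g : ℤ → ℤ) : Prop where
  periodic : ∀ j, g (j + N) = g j - d
  odd : ∀ j, g (e - j) = -g j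

namespace IsFolded

variable {N d e : ℤ} {g g' : ℤ → ℤ}

theorem add_mul (hg : IsFolded N d e g) (j k : ℤ) : g (j + N * k) = g j - d * k := by
  induction k using Int.induction_on with
  | zero => simp
  | succ k ih =>
    rw [show j + N * ((k : ℤ) + 1) = j + N * k + N by ring, hg.periodic, ih]
    ring
  | pred k ih =>
    have := hg.periodic (j + N * (-(k : ℤ) - 1))
    rw [show j + N * (-(k : ℤ) - 1) + N = j + N * -(k : ℤ) by ring, ih] at this
    linarith

/-- Oddness about the second centre `(e + N) / 2`. -/
theorem reflect (hg : IsFolded N d e g) (j : ℤ) : g j = -d - g (e + N - j) := by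
  have h1 := hg.periodic (e - j)
  have h2 := hg.odd j
  rw [show e - j + N = e + N - j by ring] at h1
  linarith

/-- A folded function is determined by its values between two neighbouring centres. -/
theorem eq_of_eqOn (hg : IsFolded N d e g) (hg' : IsFolded N d e g') {M : ℤ} (hN : 0 < N)
    (he : -1 ≤ e) (hM : e + N ≤ 2 * M + 1) (h : ∀ j, 0 ≤ j → j ≤ M → g j = g' j) : g = g' := by
  funext j
  have h1 := Int.emod_nonneg j hN.ne'
  have h2 := Int.emod_lt_of_pos j hN
  rw [← Int.emod_add_mul_ediv j N, hg.add_mul, hg'.add_mul]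
  congr 1
  by_cases hj : j % N ≤ M
  · exact h _ h1 hj
  · rw [hg.reflect, hg'.reflect, h _ (by omega) (by omega)]

/-- The inequalities `g v - g u ≤ 1` that express the core property need to be checked between two
neighbouring centres only, if they are complemented by bounds near the centres. The upper end `M` of
the range is the centre `(e + N) / 2`, rounded down. -/
theorem sub_le_one (hg : IsFolded N d e g) {M p : ℤ} (hd : 1 ≤ d) (hN : d < N)
    (he : e = -1 ∨ e = 0) (hM : e + N = 2 * M + d % 2)
    (h0 : g 0 = 0) (hend : -d - 1 ≤ 2 * g M) (hend' : 2 * g M ≤ -d + 1)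
    (hstep : ∀ x, 0 ≤ x → x < M → g x - g (x + 1) ≤ 1)
    (hmid : ∀ x y, 0 ≤ x → x ≤ y → y ≤ M → y - x ≤ p - 1 → g y - g x ≤ 1)
    (hleft : ∀ x, 0 ≤ x → x ≤ M → 2 * x - e ≤ p - 1 → g x ≤ 0)
    (hright : d % 2 = 0 → ∀ x, 0 ≤ x → x ≤ M → 2 * (M - x) ≤ p - 1 → -d ≤ 2 * g x)
    (hright' : d % 2 = 1 → ∀ x, 0 ≤ x → x ≤ M → M + 1 - x ≤ p - 1 → -d - 1 ≤ 2 * g x)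
    (u v : ℤ) (huv : -1 ≤ v - u) (hvu : v - u ≤ p - 1) : g v - g u ≤ 1 := by
  have hd2 : d % 2 = 0 ∨ d % 2 = 1 := Int.emod_two_eq_zero_or_one d
  -- windows around the centre `e / 2`
  have hcl : ∀ x y, 0 ≤ x → x ≤ y → y ≤ M → x + y - e ≤ p - 1 → g x + g y ≤ 1 := by
    intro x y hx hxy hy h
    have h1 := hleft x hx (by omega) (by omega)
    have h2 := hmid x y hx hxy hy (by omega)
    omega
  -- windows around the centre `(e + N) / 2`
  have hcr : ∀ x y, 0 ≤ x → x ≤ y → y ≤ M → e + N - x - y ≤ p - 1 → -d - 1 ≤ g x + g y := by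
    intro x y hx hxy hy h
    rcases hd2 with h2 | h2
    · have h3 := hright h2 y (by omega) hy (by omega)
      have h4 := hmid x y hx hxy hy (by omega)
      omega
    · have h3 := hright' h2 y (by omega) hy (by omega)
      have h4 := hright' h2 x (by omega) (by omega) (by omega)
      omega
  -- windows that contain two centres
  have hcc : ∀ x y, 0 ≤ x → x ≤ M → 0 ≤ y → y ≤ M → N - x + y ≤ p - 1 →
      g y - g x ≤ 1 + d := by
    intro x y hx hxM hy hyM h
    have h1 := hmid 0 y le_rfl hy hyM (by omega)
    rcases hd2 with h2 | h2
    · have h3 := hmid x M hx hxM le_rfl (by omega)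
      omega
    · have h3 := hright' h2 x hx hxM (by omega)
      omega
  have key : ∀ u v, 0 ≤ u → u < N → -1 ≤ v - u → v - u ≤ p - 1 → v - u < N → g v - g u ≤ 1 := by
    intro u v hu huN huv hvu hlt
    rcases eq_or_ne v (u - 1) with rfl | hne
    · rcases eq_or_ne u 0 with rfl | hu0
      · have h1 := hg.odd (e + 1)
        rw [show e - (e + 1) = 0 - 1 by ring] at h1
        rcases he with rfl | rfl
        · rw [show (-1 : ℤ) + 1 = 0 by ring] at h1
          omega
        · have := hstep 0 le_rfl (by omega)
          omega
      · by_cases huM : u ≤ M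
        · have := hstep (u - 1) (by omega) (by omega)
          rw [sub_add_cancel] at this
          exact this
        · by_cases huM' : u = M + 1
          · have h1 := hg.reflect u
            rw [huM', show M + 1 - 1 = M by ring]
            rw [huM', show e + N - (M + 1) = M - 1 + d % 2 by omega] at h1
            rcases hd2 with h2 | h2 <;> rw [h2] at h1
            · have h3 := hstep (M - 1) (by omega) (by omega)
              rw [sub_add_cancel] at h3
              rw [add_zero] at h1
              omega
            · rw [sub_add_cancel] at h1
              omega
          · have h1 := hg.reflect u
            have h2 := hg.reflect (u - 1)
            have h3 := hstep (e + N - u) (by omega) (by omega)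
            rw [show e + N - (u - 1) = e + N - u + 1 by ring] at h2
            omega
    have huv : u ≤ v := by omega
    by_cases huM : u ≤ M
    · by_cases hvM : v ≤ M
      · exact hmid u v hu huv hvM hvu
      · by_cases hvN : v < N
        · have h1 := hg.reflect v
          rcases le_total u (e + N - v) with h | h
          · have := hcr u (e + N - v) hu h (by omega) (by omega)
            omega
          · have := hcr (e + N - v) u (by omega) h (by omega) (by omega)
            omega
        · have h1 := hg.periodic (v - N)
          rw [sub_add_cancel] at h1
          have := hcc u (v - N) hu huM (by omega) (by omega) (by omega)
          omega
    · have h1 := hg.reflect u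
      by_cases hvN : v < N
      · have h2 := hg.reflect v
        have := hmid (e + N - v) (e + N - u) (by omega) (by omega) (by omega) (by omega)
        omega
      · have h2 := hg.periodic (v - N)
        rw [sub_add_cancel] at h2
        by_cases hvM : v ≤ N + M
        · rcases le_total (e + N - u) (v - N) with h | h
          · have := hcl (e + N - u) (v - N) (by omega) h (by omega) (by omega)
            omega
          · have := hcl (v - N) (e + N - u) (by omega) h (by omega) (by omega)
            omega
        · have h3 := hg.reflect (v - N)
          have := hcc (e + N - (v - N)) (e + N - u) (by omega) (by omega) (by omega) (by omega)
            (by omega)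
          omega
  have hN0 : 0 < N := by omega
  have h1 := Int.emod_nonneg u hN0.ne'
  have h2 := Int.emod_lt_of_pos u hN0
  have h3 := Int.emod_add_mul_ediv u N
  have h4 := hg.add_mul (u % N) (u / N)
  rw [h3] at h4
  by_cases hlt : v - u < N
  · have h5 := hg.add_mul (u % N + (v - u)) (u / N)
    rw [show u % N + (v - u) + N * (u / N) = v by linarith] at h5
    have := key (u % N) (u % N + (v - u)) h1 h2 (by omega) (by omega) (by omega)
    omega
  -- a longer window is shortened by a multiple of the period, which only raises the difference
  · have h6 := Int.emod_nonneg (v - u) hN0.ne'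
    have h7 := Int.emod_lt_of_pos (v - u) hN0
    have h8 := Int.emod_add_mul_ediv (v - u) N
    have h9 : 0 ≤ (v - u) / N := Int.ediv_nonneg (by omega) hN0.le
    have h10 : 0 ≤ d * ((v - u) / N) := mul_nonneg (by omega) h9
    have h11 : 0 ≤ N * ((v - u) / N) := mul_nonneg (by omega) h9
    have h5 := hg.add_mul (u % N + (v - u) % N) (u / N + (v - u) / N)
    rw [show u % N + (v - u) % N + N * (u / N + (v - u) / N) = v by linarith, mul_add] at h5
    have := key (u % N) (u % N + (v - u) % N) h1 h2 (by omega) (by omega) (by omega)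
    omega

end IsFolded

/-- The extension of a function on `{0, …, M}`, where `M = ⌊(e + N) / 2⌋`, by the symmetries of
`IsFolded`. -/
def foldExtend (N d e M : ℤ) (h : ℤ → ℤ) (j : ℤ) : ℤ :=
  (if j % N ≤ M then h (j % N) else -d - h (e + N - j % N)) - d * (j / N)

theorem foldExtend_add_mul {N d e M : ℤ} {h : ℤ → ℤ} {r : ℤ} (hr : 0 ≤ r) (hrN : r < N) (q : ℤ) :
    foldExtend N d e M h (r + N * q) =
      (if r ≤ M then h r else -d - h (e + N - r)) - d * q := by
  rw [foldExtend, Int.add_mul_emod_self_left, Int.emod_eq_of_lt hr hrN,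
    Int.add_mul_ediv_left _ _ (by omega), Int.ediv_eq_zero_of_lt hr hrN, zero_add]

theorem foldExtend_of_le {N d e M : ℤ} {h : ℤ → ℤ} (hMN : M < N) {j : ℤ} (hj : 0 ≤ j)
    (hjM : j ≤ M) : foldExtend N d e M h j = h j := by
  have := foldExtend_add_mul (d := d) (e := e) (M := M) (h := h) hj (hjM.trans_lt hMN) 0
  simpa [hjM] using this

theorem isFolded_foldExtend {N d e M : ℤ} {h : ℤ → ℤ} (hN : 0 < N) (he : e = -1 ∨ e = 0)
    (hM : e + N = 2 * M + d % 2) (h0 : h 0 = 0) (hend : d % 2 = 0 → 2 * h M = -d) :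
    IsFolded N d e (foldExtend N d e M h) := by
  have hd2 : d % 2 = 0 ∨ d % 2 = 1 := Int.emod_two_eq_zero_or_one d
  have hrq : ∀ j : ℤ, ∃ r q, 0 ≤ r ∧ r < N ∧ j = r + N * q := fun j =>
    ⟨j % N, j / N, Int.emod_nonneg j hN.ne', Int.emod_lt_of_pos j hN,
      (Int.emod_add_mul_ediv j N).symm⟩
  constructor
  · intro j
    obtain ⟨r, q, hr, hrN, rfl⟩ := hrq j
    rw [show r + N * q + N = r + N * (q + 1) by ring, foldExtend_add_mul hr hrN,
      foldExtend_add_mul hr hrN]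
    ring
  · intro j
    obtain ⟨r, q, hr, hrN, rfl⟩ := hrq j
    rw [foldExtend_add_mul hr hrN]
    by_cases hre : e - r = 0
    · have h1 : r = 0 := by omega
      have h2 : e = 0 := by omega
      subst h1 h2
      rw [show (0 : ℤ) - (0 + N * q) = 0 + N * (-q) by ring, foldExtend_add_mul hr hrN,
        if_pos (by omega), h0]
      ring
    · rw [show e - (r + N * q) = (e + N - r) + N * (-1 - q) by ring,
        foldExtend_add_mul (by omega) (by omega)]
      by_cases h1 : r ≤ M
      · rw [if_pos h1]
        by_cases h2 : e + N - r ≤ M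
        · -- both `r` and its mirror image lie in the domain: they are the centre
          rw [if_pos h2]
          have h3 : r = M := by omega
          have h4 : e + N - r = M := by omega
          have h5 := hend (by omega)
          rw [h4, h3]
          linarith
        · rw [if_neg h2, show e + N - (e + N - r) = r by ring]
          ring
      · rw [if_neg h1, if_pos (by omega)]
        ring

/-! ### Column functions of the abacus -/

/-- Twice the centre about which the column function of the abacus is odd. -/
def axis (s : ℕ) : ℤ := if Odd s then -1 else 0

/-- The integer `x` for which the position in row `i` and column `j` has the label `2 * x + 1`. All
integer columns are allowed. -/
def pos (s d : ℕ) (i j : ℤ) : ℤ :=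
  (abacusStart s d - 1) / 2 + ((s : ℤ) + d) * i + d * j

section

variable {s d p : ℕ} {μ ν : YoungDiagram} {g : ℤ → ℤ}

theorem odd_or_odd (hsd : Nat.Coprime s d) : s % 2 = 1 ∨ d % 2 = 1 := by
  by_contra h
  have : 2 ∣ Nat.gcd s d := Nat.dvd_gcd (by omega) (by omega)
  rw [Nat.Coprime.gcd_eq_one hsd] at this
  omega

theorem isCoprime_add (hsd : Nat.Coprime s d) : IsCoprime ((s : ℤ) + d) d := by
  have := (Nat.isCoprime_iff_coprime.2 hsd).add_mul_left_left 1
  simpa using this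

theorem two_mul_base (hsd : Nat.Coprime s d) :
    2 * ((abacusStart s d - 1) / 2) + 1 = abacusStart s d := by
  have := odd_or_odd hsd
  rw [abacusStart]
  split_ifs with h <;> rw [Nat.odd_iff] at h <;> omega

theorem label_eq (hsd : Nat.Coprime s d) (i : ℤ) (j : ℕ) :
    label s d i j = 2 * pos s d i j + 1 := by
  have := two_mul_base hsd
  rw [label, pos]
  linear_combination -this

theorem neg_one_sub_pos (hsd : Nat.Coprime s d) (i j : ℤ) :
    -1 - pos s d i j = pos s d (1 - i) (axis s - j) := by
  have h1 := two_mul_base hsd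
  have h2 : -abacusStart s d = s + d + d * axis s := by
    rw [abacusStart, axis]
    split_ifs <;> ring
  rw [pos, pos]
  linear_combination h2 - h1

theorem pos_mono (s d : ℕ) {i i' : ℤ} (h : i ≤ i') (j : ℤ) : pos s d i j ≤ pos s d i' j := by
  have : ((s : ℤ) + d) * i ≤ (s + d) * i' := mul_le_mul_of_nonneg_left h (by positivity)
  rw [pos, pos]
  linarith

theorem exists_pos_eq (hsd : Nat.Coprime s d) (x : ℤ) : ∃ i j, x = pos s d i j := by
  obtain ⟨u, v, huv⟩ := isCoprime_add hsd
  refine ⟨(x - (abacusStart s d - 1) / 2) * u, (x - (abacusStart s d - 1) / 2) * v, ?_⟩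
  rw [pos]
  linear_combination -(x - (abacusStart s d - 1) / 2) * huv

theorem exists_of_pos_eq_pos (hs : 0 < s) (hsd : Nat.Coprime s d) {i j i' j' : ℤ}
    (h : pos s d i j = pos s d i' j') :
    ∃ k, j' = j + ((s : ℤ) + d) * k ∧ i' = i - d * k := by
  rw [pos, pos] at h
  obtain ⟨k, hk⟩ : ((s : ℤ) + d) ∣ j' - j := by
    refine (isCoprime_add hsd).dvd_of_dvd_mul_left (⟨i - i', ?_⟩)
    linear_combination -h
  refine ⟨k, by linarith, ?_⟩
  have h0 : (s : ℤ) + d ≠ 0 := by positivity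
  apply mul_left_cancel₀ h0
  linear_combination -h - d * hk

/-- `g` has the properties of the column function of a self-conjugate `(s, s + d, …, s + pd)`-core.
Subtracting `s + k * d` from the number of a position in column `v` leads to column `u = v + 1 - k`,
one row lower, which accounts for the range of `v - u`. -/
structure IsColumnFun (s d p : ℕ) (g : ℤ → ℤ) : Prop where
  folded : IsFolded ((s : ℤ) + d) d (axis s) g
  sub_le_one : ∀ u v : ℤ, -1 ≤ v - u → v - u ≤ p - 1 → g v - g u ≤ 1

/-- `g` is the column function of `μ`: in column `j`, the positions that belong to the beta set of
`μ` are those in the rows up to `g j`. -/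
def Represents (s d : ℕ) (μ : YoungDiagram) (g : ℤ → ℤ) : Prop :=
  ∀ i j, i ≤ g j ↔ pos s d i j ∈ betaSet μ

theorem exists_isColumnFun (hs : 0 < s) (hsd : Nat.Coprime s d) (hp : 1 ≤ p)
    (hμ : μ ∈ SC s d p) : ∃ g, IsColumnFun s d p g ∧ Represents s d μ g := by
  obtain ⟨hT, hcore⟩ := hμ
  have hsymm := mem_betaSet_iff_of_transpose_eq hT
  have hbdd := betaSet_bddAbove μ
  have hsub : ∀ k ≤ p, ∀ b ∈ betaSet μ, b - (s + k * d : ℕ) ∈ betaSet μ := fun k hk =>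
    (isCore_iff μ (by omega)).1 (hcore k hk)
  have hN : (1 : ℤ) ≤ (s : ℤ) + d := by omega
  have hcol : ∀ j : ℤ, ∃ n : ℤ, ∀ i : ℤ, i ≤ n ↔ pos s d i j ∈ betaSet μ := by
    intro j
    have hpos : ∀ i, pos s d i j = pos s d 0 j + ((s : ℤ) + d) * i := fun i => by
      rw [pos, pos]
      ring
    obtain ⟨n, hn, hmax⟩ := Int.exists_greatest_of_bdd (P := fun i => pos s d i j ∈ betaSet μ)
      ⟨|(μ.rowLen 0 : ℤ) - pos s d 0 j|, fun i hi => by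
        have h1 := hbdd _ hi
        rw [hpos] at h1
        by_contra hlt
        have h2 := le_abs_self ((μ.rowLen 0 : ℤ) - pos s d 0 j)
        have h3 := abs_nonneg ((μ.rowLen 0 : ℤ) - pos s d 0 j)
        nlinarith⟩
      ⟨-(|(μ.rowLen 0 : ℤ) + 1 + pos s d 0 j|), by
        rw [hsymm]
        intro h
        have h1 := hbdd _ h
        rw [hpos] at h1
        have h2 := le_abs_self ((μ.rowLen 0 : ℤ) + 1 + pos s d 0 j)
        have h3 := abs_nonneg ((μ.rowLen 0 : ℤ) + 1 + pos s d 0 j)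
        nlinarith⟩
    refine ⟨n, fun i => ⟨fun hi => ?_, hmax i⟩⟩
    obtain ⟨k, hk⟩ := Int.eq_ofNat_of_zero_le (sub_nonneg.2 hi)
    have hdown : ∀ k : ℕ, pos s d (n - k) j ∈ betaSet μ := by
      intro k
      induction k with
      | zero => simpa using hn
      | succ k ih =>
        have := hsub 1 hp _ ih
        convert this using 1
        rw [pos, pos]
        push_cast
        ring
    rw [show i = n - k by omega]
    exact hdown k
  choose g hg using hcol
  refine ⟨g, ⟨⟨fun j => ?_, fun j => ?_⟩, fun u v h1 h2 => ?_⟩, fun i j => hg j i⟩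
  · have h : ∀ i, i ≤ g (j + ((s : ℤ) + d)) ↔ i ≤ g j - d := fun i => by
      rw [hg, le_sub_iff_add_le, hg]
      have : pos s d i (j + ((s : ℤ) + d)) = pos s d (i + d) j := by
        rw [pos, pos]
        ring
      rw [this]
    have h1 := h (g (j + ((s : ℤ) + d)))
    have h2 := h (g j - d)
    omega
  · have h : ∀ i, i ≤ g (axis s - j) ↔ ¬ 1 - i ≤ g j := fun i => by
      rw [hg, hg, hsymm, neg_one_sub_pos hsd, sub_sub_cancel]
    have h1 := h (g (axis s - j))
    have h2 := h (-g j)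
    omega
  · obtain ⟨k, hk⟩ := Int.eq_ofNat_of_zero_le (show 0 ≤ v - u + 1 by omega)
    have h3 := hsub k (by omega) _ ((hg v (g v)).1 le_rfl)
    have h4 : pos s d (g v) v - (s + k * d : ℕ) = pos s d (g v - 1) u := by
      rw [pos, pos, show v = u + k - 1 by omega]
      push_cast
      ring
    rw [h4, ← hg] at h3
    omega

theorem exists_mem_SC (hs : 0 < s) (hsd : Nat.Coprime s d) (hp : 2 ≤ p)
    (hg : IsColumnFun s d p g) : ∃ μ ∈ SC s d p, Represents s d μ g := by
  have hN : (1 : ℤ) ≤ (s : ℤ) + d := by omega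
  let B : Set ℤ := {x | ∃ i j, x = pos s d i j ∧ i ≤ g j}
  have hmem : ∀ i j, pos s d i j ∈ B ↔ i ≤ g j := by
    refine fun i j => ⟨?_, fun h => ⟨i, j, rfl, h⟩⟩
    rintro ⟨i', j', hpos, h⟩
    obtain ⟨k, rfl, rfl⟩ := exists_of_pos_eq_pos hs hsd hpos
    have := hg.folded.add_mul j k
    omega
  have hsymm : ∀ z, z ∈ B ↔ -1 - z ∉ B := by
    intro z
    obtain ⟨i, j, rfl⟩ := exists_pos_eq hsd z
    rw [neg_one_sub_pos hsd, hmem, hmem, hg.folded.odd]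
    omega
  -- on one period `g` is bounded, as its steps are at most `1`
  have hbound : ∀ n : ℕ, g n ≤ g 0 + n := by
    intro n
    induction n with
    | zero => simp
    | succ n ih =>
      have := hg.sub_le_one n (n + 1) (by omega) (by omega)
      push_cast
      omega
  obtain ⟨μ, hμ, hB⟩ := exists_betaSet_eq hsymm
    (n := ((abacusStart s d - 1) / 2 + ((s : ℤ) + d) * (g 0 + (s + d)) + d * (s + d)).natAbs + 1)
    (by
      rintro z ⟨i, j, rfl, hij⟩
      obtain ⟨n, hn⟩ := Int.eq_ofNat_of_zero_le
        (Int.emod_nonneg j (show (s : ℤ) + d ≠ 0 by omega))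
      have h1 := Int.emod_lt_of_pos j (show 0 < (s : ℤ) + d by omega)
      have h2 := Int.emod_add_mul_ediv j ((s : ℤ) + d)
      rw [hn] at h1 h2
      have h3 := hg.folded.add_mul n (j / ((s : ℤ) + d))
      rw [h2] at h3
      have h4 := hbound n
      have h5 : pos s d i j = (abacusStart s d - 1) / 2 +
          ((s : ℤ) + d) * (i + d * (j / ((s : ℤ) + d))) + d * n := by
        rw [pos]
        linear_combination -d * h2
      have h6 : ((s : ℤ) + d) * (i + d * (j / ((s : ℤ) + d))) ≤
          ((s : ℤ) + d) * (g 0 + (s + d)) :=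
        mul_le_mul_of_nonneg_left (by omega) (by omega)
      have h7 : (d : ℤ) * n ≤ d * (s + d) := mul_le_mul_of_nonneg_left (by omega) (by omega)
      omega)
  refine ⟨μ, ⟨hμ, fun k hk => (isCore_iff μ (by omega)).2 ?_⟩, fun i j => by rw [hB, hmem]⟩
  rw [hB]
  rintro _ ⟨i, j, rfl, hij⟩
  have h4 : pos s d i j - (s + k * d : ℕ) = pos s d (i - 1) (j + 1 - k) := by
    rw [pos, pos]
    push_cast
    ring
  rw [h4, hmem]
  have := hg.sub_le_one (j + 1 - k) j (by omega) (by omega)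
  omega

theorem Represents.eq (hsd : Nat.Coprime s d) (hμ : Represents s d μ g)
    (hν : Represents s d ν g) : μ = ν := by
  apply betaSet_injective
  ext x
  obtain ⟨i, j, rfl⟩ := exists_pos_eq hsd x
  rw [← hμ, ← hν]

/-- The beads with a positive label and the spacers with a negative label are the positions in the
rows up to `g j`, so both cases of the abacus function give `g j`. -/
theorem Represents.abacusFun_eq (hsd : Nat.Coprime s d) (hT : μ.transpose = μ)
    (hμ : Represents s d μ g) (j : ℕ) : abacusFun s d μ j = g j := by
  have hlabel := fun i => label_eq hsd i j
  have hmono : ∀ i i', i ≤ i' → label s d i j ≤ label s d i' j := fun i i' h => by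
    have := pos_mono s d h j
    rw [hlabel, hlabel]
    omega
  have hbead_pos : ∀ i, 0 < label s d i j → (IsBead s d μ i j ↔ i ≤ g j) := by
    intro i hi
    have h1 := hlabel i
    rw [IsBead, mem_MD_iff hT, hμ]
    constructor
    · rintro ⟨b, hb, h0, h⟩
      rwa [show pos s d i j = b by omega]
    · exact fun h => ⟨_, h, by omega, by omega⟩
  have hbead_neg : ∀ i, label s d i j < 0 → (IsBead s d μ i j ↔ ¬ i ≤ g j) := by
    intro i hi
    have h1 := hlabel i
    rw [IsBead, mem_MD_iff hT, hμ, mem_betaSet_iff_of_transpose_eq hT, not_not]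
    constructor
    · rintro ⟨b, hb, h0, h⟩
      rwa [show -1 - pos s d i j = b by omega]
    · exact fun h => ⟨_, h, by omega, by omega⟩
  have hg := hlabel (g j)
  rw [abacusFun]
  split_ifs with h
  · obtain ⟨i₀, h0, hi₀⟩ := h
    have hpos := h0.trans_le (hmono _ _ ((hbead_pos i₀ h0).1 hi₀))
    refine IsGreatest.csSup_eq ⟨(hbead_pos _ hpos).2 le_rfl, fun i hi => ?_⟩
    by_contra hlt
    have hi' := hpos.trans_le (hmono (g j) i (by omega))
    exact hlt ((hbead_pos i hi').1 hi)
  · have hneg : label s d (g j) j < 0 := by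
      by_contra hlt
      have hpos : 0 < label s d (g j) j := by omega
      exact h ⟨_, hpos, (hbead_pos _ hpos).2 le_rfl⟩
    refine IsGreatest.csSup_eq ⟨⟨hneg, by simp [hbead_neg _ hneg]⟩, fun i hi => ?_⟩
    have := hbead_neg i hi.1
    exact not_not.1 fun hlt => hi.2 (this.2 hlt)

end

/-! ### Words in lattice paths as inequalities between heights -/

/-- The steps of the path with the heights `h 0, …, h m`. -/
def steps (h : ℕ → ℤ) (m : ℕ) : List (ℤ × ℤ) :=
  (List.range m).map fun j => (1, h (j + 1) - h j)

theorem length_steps (h : ℕ → ℤ) (m : ℕ) : (steps h m).length = m := by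
  simp [steps]

theorem steps_getElem? (h : ℕ → ℤ) (m j : ℕ) (y : ℤ) :
    (steps h m)[j]? = some (1, y) ↔ j < m ∧ h (j + 1) - h j = y := by
  by_cases hj : j < m
  · rw [List.getElem?_eq_getElem (by rwa [length_steps])]
    simp [steps, hj]
  · rw [List.getElem?_eq_none (by rw [length_steps]; omega)]
    simp [hj]

theorem steps_sum (h : ℕ → ℤ) (m : ℕ) : (steps h m).sum = ((m : ℤ), h m - h 0) := by
  induction m with
  | zero => simp [steps, Prod.zero_eq_mk]
  | succ m ih =>
    rw [steps, List.range_succ, List.map_append, List.sum_append]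
    change (steps h m).sum + _ = _
    rw [ih]
    ext <;> simp

theorem steps_mem_iff (h : ℕ → ℤ) (m : ℕ) :
    (∀ x ∈ steps h m, x = U ∨ x = D ∨ x = F) ↔
      ∀ j < m, h (j + 1) - h j ≤ 1 ∧ h j - h (j + 1) ≤ 1 := by
  simp only [steps, List.mem_map, List.mem_range, forall_exists_index, and_imp,
    forall_apply_eq_imp_iff₂, U, D, F, Prod.mk.injEq, true_and]
  refine forall₂_congr fun j _ => ?_
  omega

/-- Every path with steps `U`, `D`, `F` is given by its heights. -/
theorem exists_steps_eq (P : List (ℤ × ℤ)) (hP : ∀ x ∈ P, x = U ∨ x = D ∨ x = F) :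
    ∃ h : ℕ → ℤ, h 0 = 0 ∧ steps h P.length = P := by
  refine ⟨fun j => (P.take j).sum.2, by simp, ?_⟩
  refine List.ext_getElem (length_steps _ _) fun j h1 h2 => ?_
  have hj : (P[j]).1 = 1 := by
    rcases hP _ (List.getElem_mem h2) with h | h | h <;> rw [h] <;> rfl
  simp only [steps, List.getElem_map, List.getElem_range]
  rw [List.sum_take_succ _ _ h2]
  ext <;> simp [hj]

/-- A path determines its heights. -/
theorem steps_inj {h h' : ℕ → ℤ} {m : ℕ} (h0 : h 0 = h' 0) (heq : steps h m = steps h' m) :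
    ∀ j ≤ m, h j = h' j := by
  intro j
  induction j with
  | zero => exact fun _ => h0
  | succ j ih =>
    intro hj
    have h1 := (steps_getElem? h m j _).2 ⟨hj, rfl⟩
    rw [heq, steps_getElem?] at h1
    have := ih (by omega)
    omega

theorem steps_congr {h h' : ℕ → ℤ} {m : ℕ} (heq : ∀ j ≤ m, h j = h' j) :
    steps h m = steps h' m := by
  refine List.map_congr_left fun j hj => ?_
  have := List.mem_range.1 hj
  rw [heq j (by omega), heq (j + 1) (by omega)]

theorem reverse_steps (h : ℕ → ℤ) (m : ℕ) :
    (steps h m).reverse = steps (fun j => -h (m - j)) m := by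
  refine List.ext_getElem (by simp [length_steps]) fun j h1 h2 => ?_
  rw [length_steps] at h2
  simp only [steps, List.getElem_reverse, List.getElem_map, List.getElem_range, List.length_map,
    List.length_range]
  rw [show m - 1 - j + 1 = m - j by omega, show m - 1 - j = m - (j + 1) by omega]
  ext
  · rfl
  · simp only
    ring

theorem containsUFU_steps_iff (h : ℕ → ℤ) (m i : ℕ) :
    ContainsUFU i (steps h m) ↔ ∃ k, k + i + 2 ≤ m ∧
      (∀ t, 1 ≤ t → t ≤ i + 1 → h (k + t) = h k + 1) ∧ h (k + i + 2) = h k + 2 := by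
  rw [ContainsUFU, List.infix_iff_getElem?]
  simp only [length_steps, List.length_cons, List.length_append, List.length_replicate,
    List.length_nil]
  refine exists_congr fun k => ?_
  constructor
  · rintro ⟨h1, h2⟩
    have h3 := h2 0 (by omega)
    rw [List.getElem_cons_zero, U, steps_getElem?, zero_add] at h3
    have h4 : ∀ t, 1 ≤ t → t ≤ i + 1 → h (k + t) = h k + 1 := by
      intro t ht
      induction t, ht using Nat.le_induction with
      | base => intro _; omega
      | succ t ht ih =>
        intro hti
        have h5 := h2 t (by omega)
        rw [List.getElem_cons, dif_neg (by omega), List.getElem_append_left (by simp; omega),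
          List.getElem_replicate, F, steps_getElem?] at h5
        have := ih (by omega)
        rw [add_comm t k] at h5
        rw [← add_assoc]
        omega
    refine ⟨by omega, h4, ?_⟩
    have h5 := h2 (i + 1) (by omega)
    rw [List.getElem_cons, dif_neg (by omega), List.getElem_append_right (by simp)] at h5
    simp only [List.getElem_singleton] at h5
    rw [U, steps_getElem?, show i + 1 + k = k + (i + 1) by omega] at h5
    have h6 := h4 (i + 1) (by omega) le_rfl
    rw [show k + i + 2 = k + (i + 1) + 1 by omega]
    omega
  · rintro ⟨h1, h2, h3⟩
    refine ⟨by omega, fun t ht => ?_⟩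
    rw [List.getElem_cons]
    split_ifs with h4
    · subst h4
      rw [U, steps_getElem?, zero_add]
      exact ⟨by omega, by have := h2 1 le_rfl (by omega); omega⟩
    · rw [List.getElem_append]
      split_ifs with h5
      · rw [List.length_replicate] at h5
        rw [List.getElem_replicate, F, steps_getElem?, add_comm t k]
        refine ⟨by omega, ?_⟩
        have h6 := h2 t (by omega) (by omega)
        have h7 := h2 (t + 1) (by omega) (by omega)
        rw [← add_assoc] at h7
        omega
      · rw [List.length_replicate] at h5
        have h6 : t = i + 1 := by omega
        subst h6
        rw [List.getElem_singleton, U, steps_getElem?, show i + 1 + k = k + (i + 1) by omega]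
        refine ⟨by omega, ?_⟩
        have h7 := h2 (i + 1) (by omega) le_rfl
        rw [show k + i + 2 = k + (i + 1) + 1 by omega] at h3
        omega

theorem startsFU_steps_iff (h : ℕ → ℤ) (m i : ℕ) :
    StartsFU i (steps h m) ↔ i < m ∧ (∀ t ≤ i, h t = h 0) ∧ h (i + 1) = h 0 + 1 := by
  rw [StartsFU, List.prefix_iff_getElem?]
  simp only [List.length_append, List.length_replicate, List.length_cons, List.length_nil]
  constructor
  · intro h2
    have h4 : ∀ t, t ≤ i → h t = h 0 := by
      intro t
      induction t with
      | zero => intro _; rfl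
      | succ t ih =>
        intro hti
        have h5 := h2 t (by omega)
        rw [List.getElem_append_left (by simp; omega), List.getElem_replicate, F,
          steps_getElem?] at h5
        have := ih (by omega)
        omega
    have h5 := h2 i (by omega)
    rw [List.getElem_append_right (by simp)] at h5
    simp only [List.getElem_singleton] at h5
    rw [U, steps_getElem?] at h5
    have h6 := h4 i le_rfl
    exact ⟨h5.1, h4, by omega⟩
  · rintro ⟨h1, h2, h3⟩ t ht
    rw [List.getElem_append]
    split_ifs with h5
    · rw [List.length_replicate] at h5
      rw [List.getElem_replicate, F, steps_getElem?]
      refine ⟨by omega, ?_⟩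
      rw [h2 (t + 1) (by omega), h2 t (by omega), sub_self]
    · rw [List.length_replicate] at h5
      have h6 : t = i := by omega
      subst h6
      rw [List.getElem_singleton, U, steps_getElem?]
      have := h2 t le_rfl
      exact ⟨h1, by omega⟩

theorem endsUF_steps_iff (h : ℕ → ℤ) (m i : ℕ) :
    EndsUF i (steps h m) ↔ StartsFU i (steps (fun j => -h (m - j)) m) := by
  rw [EndsUF, StartsFU, ← reverse_steps, ← List.reverse_prefix]
  simp

/-- A shortest window in which the path rises by more than `1` is a word `U Fⁱ U`. -/
theorem forall_not_containsUFU_iff {h : ℕ → ℤ} {m : ℕ} (hstep : ∀ j < m, h (j + 1) - h j ≤ 1)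
    (p : ℕ) : (3 ≤ p → ∀ i ≤ p - 3, ¬ ContainsUFU i (steps h m)) ↔
      ∀ x y, x ≤ y → y ≤ m → y - x ≤ p - 1 → h y - h x ≤ 1 := by
  constructor
  · intro H
    have key : ∀ n, n ≤ p - 1 → ∀ x, x + n ≤ m → h (x + n) - h x ≤ 1 := by
      intro n
      induction n using Nat.strong_induction_on with
      | _ n ih =>
        intro hnp x hx
        by_contra hlt
        have hn0 : n ≠ 0 := by
          rintro rfl
          simp at hlt
        have hn1 : n ≠ 1 := by
          rintro rfl
          exact hlt (hstep x (by omega))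
        obtain ⟨i, rfl⟩ : ∃ i, n = i + 2 := ⟨n - 2, by omega⟩
        have h1 : ∀ t, 1 ≤ t → t ≤ i + 1 → h (x + t) ≤ h x + 1 ∧ h (x + (i + 2)) ≤ h (x + t) + 1 := by
          intro t ht hti
          have h2 := ih t (by omega) (by omega) x (by omega)
          have h3 := ih (i + 2 - t) (by omega) (by omega) (x + t) (by omega)
          rw [show x + t + (i + 2 - t) = x + (i + 2) by omega] at h3
          omega
        refine H (by omega) i (by omega) ((containsUFU_steps_iff h m i).2 ⟨x, by omega, ?_, ?_⟩)
        · intro t ht hti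
          have := h1 t ht hti
          omega
        · have := h1 1 le_rfl (by omega)
          rw [add_assoc]
          omega
    intro x y hxy hy hp
    have := key (y - x) hp x (by omega)
    rwa [show x + (y - x) = y by omega] at this
  · intro H hp i hi hc
    obtain ⟨k, h1, -, h3⟩ := (containsUFU_steps_iff h m i).1 hc
    have := H k (k + i + 2) (by omega) h1 (by omega)
    omega

/-- The first `x ≤ B` with `h x > h 0` ends an initial word `Fʲ U`, since before it the path cannot
dip below `h 0` without a rise by more than `1`. -/
theorem forall_not_startsFU_iff {h : ℕ → ℤ} {m p B : ℕ}
    (hwin : ∀ x y, x ≤ y → y ≤ m → y - x ≤ p - 1 → h y - h x ≤ 1) (hB : B ≤ p - 1) :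
    (∀ j < B, ¬ StartsFU j (steps h m)) ↔ ∀ x ≤ m, x ≤ B → h x ≤ h 0 := by
  constructor
  · intro H x
    induction x using Nat.strong_induction_on with
    | _ x ih =>
      intro hxm hxB
      by_contra hlt
      have hx0 : x ≠ 0 := by
        rintro rfl
        exact hlt le_rfl
      have h1 : ∀ t < x, h t = h 0 ∧ h x = h 0 + 1 := fun t ht => by
        have h2 := ih t ht (by omega) (by omega)
        have h3 := hwin t x ht.le hxm (by omega)
        omega
      refine H (x - 1) (by omega) ((startsFU_steps_iff h m (x - 1)).2 ⟨by omega, ?_, ?_⟩)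
      · intro t ht
        exact (h1 t (by omega)).1
      · rw [show x - 1 + 1 = x by omega]
        exact (h1 0 (by omega)).2
  · intro H j hj hc
    obtain ⟨h1, -, h3⟩ := (startsFU_steps_iff h m j).1 hc
    have := H (j + 1) (by omega) (by omega)
    omega

theorem forall_not_endsUF_iff {h : ℕ → ℤ} {m p B : ℕ}
    (hwin : ∀ x y, x ≤ y → y ≤ m → y - x ≤ p - 1 → h y - h x ≤ 1) (hB : B ≤ p - 1) :
    (∀ j < B, ¬ EndsUF j (steps h m)) ↔ ∀ x ≤ m, m - x ≤ B → h m ≤ h x := by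
  simp only [endsUF_steps_iff]
  rw [forall_not_startsFU_iff (p := p) ?_ hB]
  · constructor
    · intro H x hx hxB
      have := H (m - x) (by omega) hxB
      simp only [show m - (m - x) = x by omega, Nat.sub_zero] at this
      omega
    · intro H x hx hxB
      have := H (m - x) (by omega) (by omega)
      simp only [Nat.sub_zero]
      omega
  · intro x y hxy hy hp
    have := hwin (m - y) (m - x) (by omega) (by omega) (by omega)
    omega

/-! ### Column functions and restricted paths -/

section

/-- The heights of the path of a column function `g`; for odd `d` the last one is prescribed. -/
def pathHeight (s d : ℕ) (g : ℤ → ℤ) (j : ℕ) : ℤ :=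
  if Odd d ∧ j = s / 2 + (d + 1) / 2 then -(((d + 1) / 2 : ℕ) : ℤ) else g j

/-- The restrictions on a path, expressed by inequalities between its heights. -/
structure IsRestrictedHeight (s d p : ℕ) (h : ℕ → ℤ) : Prop where
  zero : h 0 = 0
  last : h (s / 2 + (d + 1) / 2) = -(((d + 1) / 2 : ℕ) : ℤ)
  step : ∀ j < s / 2 + (d + 1) / 2, h (j + 1) - h j ≤ 1 ∧ h j - h (j + 1) ≤ 1
  sub_le_one : ∀ x y, x ≤ y → y ≤ s / 2 + (d + 1) / 2 → y - x ≤ p - 1 → h y - h x ≤ 1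
  left : ∀ x ≤ s / 2 + (d + 1) / 2, 2 * (x : ℤ) - axis s ≤ p - 1 → h x ≤ 0
  right_even : d % 2 = 0 → ∀ x ≤ s / 2 + (d + 1) / 2,
    2 * (s / 2 + (d + 1) / 2 - x) ≤ p - 1 → h (s / 2 + (d + 1) / 2) ≤ h x
  right_odd : d % 2 = 1 → ∀ x ≤ s / 2 + (d + 1) / 2,
    s / 2 + (d + 1) / 2 - x ≤ p - 1 → h (s / 2 + (d + 1) / 2) ≤ h x

variable {s d p : ℕ} {g : ℤ → ℤ} {h : ℕ → ℤ} {μ : YoungDiagram}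

theorem axis_cases (s : ℕ) : (s % 2 = 1 ∧ axis s = -1) ∨ (s % 2 = 0 ∧ axis s = 0) := by
  rw [axis]
  split_ifs with h <;> rw [Nat.odd_iff] at h <;> omega

/-- In `left` and `right_even`, the bounds of `Restricted` on the lengths of the words become the
bound `p - 1` on the length of a window that is symmetric about a centre. -/
theorem restricted_steps_iff (hsd : Nat.Coprime s d) (hp : 2 ≤ p) (h0 : h 0 = 0) :
    (steps h (s / 2 + (d + 1) / 2) ∈ FreeMotzkin (((s / 2 + (d + 1) / 2 : ℕ) : ℤ))
        (-(((d + 1) / 2 : ℕ) : ℤ)) ∧ Restricted s d p (steps h (s / 2 + (d + 1) / 2))) ↔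
      IsRestrictedHeight s d p h := by
  have hax := axis_cases s
  have hpar := odd_or_odd hsd
  have hFree : steps h (s / 2 + (d + 1) / 2) ∈ FreeMotzkin (((s / 2 + (d + 1) / 2 : ℕ) : ℤ))
      (-(((d + 1) / 2 : ℕ) : ℤ)) ↔
      (∀ j < s / 2 + (d + 1) / 2, h (j + 1) - h j ≤ 1 ∧ h j - h (j + 1) ≤ 1) ∧
        h (s / 2 + (d + 1) / 2) = -(((d + 1) / 2 : ℕ) : ℤ) := by
    change _ ∧ _ ↔ _
    rw [steps_mem_iff, steps_sum, h0, sub_zero, Prod.mk.injEq]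
    exact and_congr_right fun _ => and_iff_right rfl
  rw [hFree, Restricted]
  generalize hm : s / 2 + (d + 1) / 2 = m
  simp only [Nat.odd_iff, Nat.even_iff]
  constructor
  · rintro ⟨⟨hstep, hlast⟩, hmid, hA, hB, hC⟩
    have hwin := (forall_not_containsUFU_iff (fun j hj => (hstep j hj).1) p).1 hmid
    refine ⟨h0, hm ▸ hlast, hm ▸ hstep, hm ▸ hwin, ?_, ?_, ?_⟩ <;> rw [hm]
    · intro x hx hxp
      rw [← h0]
      rcases hax with ⟨hs, ha⟩ | ⟨hs, ha⟩
      · refine (forall_not_startsFU_iff (B := (p - 2) / 2) hwin (by omega)).1 ?_ x hx (by omega)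
        intro j hj
        rcases Nat.mod_two_eq_zero_or_one d with hd | hd
        · exact (hA hs hd).1 (by omega) j (by omega)
        · exact (hB hs hd).1 (by omega) j (by omega)
      · refine (forall_not_startsFU_iff (B := (p - 1) / 2) hwin (by omega)).1 ?_ x hx (by omega)
        exact fun j hj => (hC hs (by omega)).1 (by omega) j (by omega)
    · intro hd x hx hxp
      refine (forall_not_endsUF_iff (B := (p - 1) / 2) hwin (by omega)).1 ?_ x hx (by omega)
      exact fun j hj => (hA (by omega) hd).2 (by omega) j (by omega)
    · intro hd x hx hxp
      refine (forall_not_endsUF_iff (B := p - 1) hwin (by omega)).1 ?_ x hx (by omega)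
      intro j hj
      rcases Nat.mod_two_eq_zero_or_one s with hs | hs
      · exact (hC hs hd).2 (by omega) j (by omega)
      · exact (hB hs hd).2 (by omega) j (by omega)
  · rintro ⟨-, hlast, hstep, hwin, hleft, hright, hright'⟩
    rw [hm] at hlast hstep hwin hleft hright hright'
    have hL : s % 2 = 1 → ∀ j < (p - 2) / 2, ¬ StartsFU j (steps h m) := fun hs =>
      (forall_not_startsFU_iff hwin (by omega)).2 fun x hx hxp => by
        rw [h0]
        exact hleft x hx (by omega)
    have hL' : s % 2 = 0 → ∀ j < (p - 1) / 2, ¬ StartsFU j (steps h m) := fun hs =>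
      (forall_not_startsFU_iff hwin (by omega)).2 fun x hx hxp => by
        rw [h0]
        exact hleft x hx (by omega)
    have hR : d % 2 = 0 → ∀ j < (p - 1) / 2, ¬ EndsUF j (steps h m) := fun hd =>
      (forall_not_endsUF_iff hwin (by omega)).2 fun x hx hxp => hright hd x hx (by omega)
    have hR' : d % 2 = 1 → ∀ j < p - 1, ¬ EndsUF j (steps h m) := fun hd =>
      (forall_not_endsUF_iff hwin le_rfl).2 fun x hx hxp => hright' hd x hx (by omega)
    refine ⟨⟨hstep, hlast⟩, (forall_not_containsUFU_iff (fun j hj => (hstep j hj).1) p).2 hwin,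
      fun hs hd => ⟨fun hp j hj => hL hs j (by omega), fun hp j hj => hR hd j (by omega)⟩,
      fun hs hd => ⟨fun hp j hj => hL hs j (by omega), fun hp j hj => hR' hd j (by omega)⟩,
      fun hs hd => ⟨fun hp j hj => hL' hs j (by omega), fun hp j hj => hR' hd j (by omega)⟩⟩

theorem pathHeight_of_add_le {j : ℕ} (hj : j + d % 2 ≤ s / 2 + (d + 1) / 2) :
    pathHeight s d g j = g j := by
  refine if_neg ?_
  rw [Nat.odd_iff]
  omega

theorem pathHeight_last (hd : d % 2 = 1) :
    pathHeight s d g (s / 2 + (d + 1) / 2) = -(((d + 1) / 2 : ℕ) : ℤ) :=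
  if_pos ⟨Nat.odd_iff.2 hd, rfl⟩

theorem IsColumnFun.isRestrictedHeight (hg : IsColumnFun s d p g) (hd : 0 < d)
    (hsd : Nat.Coprime s d) (hp : 2 ≤ p) : IsRestrictedHeight s d p (pathHeight s d g) := by
  have hax := axis_cases s
  have hpar := odd_or_odd hsd
  have hwin := hg.sub_le_one
  obtain ⟨M, hM⟩ : ∃ M : ℕ, s / 2 + (d + 1) / 2 = M + d % 2 :=
    ⟨s / 2 + (d + 1) / 2 - d % 2, by omega⟩
  have hsum : axis s + ((s : ℤ) + d) = 2 * M + (d % 2 : ℕ) := by omega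
  have hlow : ∀ j ≤ M, pathHeight s d g j = g j := fun j hj => pathHeight_of_add_le (by omega)
  have hg0 : g 0 = 0 := by
    have h1 := hg.folded.odd 0
    rw [sub_zero] at h1
    have h2 := hwin 0 (axis s) (by omega) (by omega)
    have h3 := hwin (axis s) 0 (by omega) (by omega)
    omega
  have hrM := hg.folded.reflect M
  rw [show axis s + ((s : ℤ) + d) - M = M + (d % 2 : ℕ) by omega] at hrM
  have hlast : pathHeight s d g (s / 2 + (d + 1) / 2) = -(((d + 1) / 2 : ℕ) : ℤ) := by
    rcases Nat.mod_two_eq_zero_or_one d with h2 | h2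
    · rw [hM, h2, add_zero, hlow M le_rfl]
      rw [h2, Nat.cast_zero, add_zero] at hrM
      omega
    · exact pathHeight_last h2
  -- for odd `d`, the prescribed last height is the smaller of `g M` and `g (M + 1)`
  have hodd : d % 2 = 1 → g M + g (M + 1) = -d ∧ g M - g (M + 1) ≤ 1 ∧ g (M + 1) - g M ≤ 1 ∧
      pathHeight s d g (M + 1) = -(((d + 1) / 2 : ℕ) : ℤ) := fun h2 => by
    rw [h2, Nat.cast_one] at hrM
    rw [hM, h2] at hlast
    exact ⟨by omega, hwin _ _ (by omega) (by omega), hwin _ _ (by omega) (by omega), hlast⟩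
  have hle : ∀ j, j ≤ M + d % 2 → j ≤ M ∨ (d % 2 = 1 ∧ j = M + 1) := fun j hj => by omega
  refine ⟨by rw [hlow 0 (Nat.zero_le _)]; exact hg0, hlast, ?_, ?_, ?_, ?_, ?_⟩ <;> rw [hM]
  · intro j hj
    rcases hle (j + 1) hj with h1 | ⟨h2, h1⟩
    · rw [hlow _ h1, hlow j (by omega)]
      exact ⟨hwin _ _ (by omega) (by omega), hwin _ _ (by omega) (by omega)⟩
    · obtain rfl : j = M := by omega
      have := hodd h2
      rw [hlow j le_rfl]
      omega
  · intro x y hxy hy hyx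
    rcases hle y hy with h1 | ⟨h2, rfl⟩
    · rw [hlow _ h1, hlow x (by omega)]
      exact hwin _ _ (by omega) (by omega)
    · rcases hle x (by omega) with h1 | ⟨-, rfl⟩
      · have h3 := hwin x (M + 1) (by omega) (by omega)
        have := hodd h2
        rw [hlow _ h1]
        omega
      · simp
  · intro x hx hxp
    rcases hle x hx with h1 | ⟨h2, rfl⟩
    · have h3 := hwin (axis s - x) x (by omega) (by omega)
      rw [hg.folded.odd] at h3
      rw [hlow _ h1]
      omega
    · have := hodd h2
      omega
  · intro h2 x hx hxp
    rw [hlow x (by omega), ← hM, hlast]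
    have h3 := hwin x (axis s + ((s : ℤ) + d) - x) (by omega) (by omega)
    have h4 := hg.folded.reflect x
    omega
  · intro h2 x hx hxp
    rcases hle x hx with h1 | ⟨-, rfl⟩
    · have h3 := hwin x (M + 1) (by omega) (by omega)
      have h4 := hwin x M (by omega) (by omega)
      have := hodd h2
      rw [hlow _ h1, h2]
      omega
    · rw [h2]

/-- The column function of a restricted path is obtained by folding its heights. For odd `d`, the
last height is not among the folded values and only serves as a bound for the others. -/
theorem IsRestrictedHeight.exists_isColumnFun (hh : IsRestrictedHeight s d p h) (hs : 0 < s)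
    (hd : 0 < d) (hsd : Nat.Coprime s d) (hp : 2 ≤ p) :
    ∃ g, IsColumnFun s d p g ∧ ∀ j ≤ s / 2 + (d + 1) / 2, pathHeight s d g j = h j := by
  have hax := axis_cases s
  have hpar := odd_or_odd hsd
  obtain ⟨h0, hlast, hstep, hwin, hleft, hright, hright'⟩ := hh
  obtain ⟨M, hM⟩ : ∃ M : ℕ, s / 2 + (d + 1) / 2 = M + d % 2 :=
    ⟨s / 2 + (d + 1) / 2 - d % 2, by omega⟩
  have hsum : axis s + ((s : ℤ) + d) = 2 * (M : ℤ) + (d : ℤ) % 2 := by omega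
  have hfold : IsFolded ((s : ℤ) + d) d (axis s)
      (foldExtend ((s : ℤ) + d) d (axis s) M fun j => h j.toNat) := by
    refine isFolded_foldExtend (by omega) (by omega) hsum h0 fun h2 => ?_
    simp only [Int.toNat_natCast]
    rw [hM, show d % 2 = 0 by omega, add_zero] at hlast
    omega
  have hval : ∀ j : ℕ, j ≤ M →
      foldExtend ((s : ℤ) + d) d (axis s) M (fun j => h j.toNat) j = h j := fun j hj => by
    rw [foldExtend_of_le (by omega) (by omega) (by omega), Int.toNat_natCast]
  generalize foldExtend ((s : ℤ) + d) d (axis s) M (fun j => h j.toNat) = g at hfold hval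
  have hendM : -(d : ℤ) - 1 ≤ 2 * h M ∧ 2 * h M ≤ -d + 1 := by
    rcases Nat.mod_two_eq_zero_or_one d with h2 | h2
    · rw [hM, h2, add_zero] at hlast
      omega
    · have h3 := (hstep M (by omega)).2
      have h4 := hright' h2 M (by omega) (by omega)
      rw [hM, h2] at hlast h4
      omega
  refine ⟨g, ⟨hfold, hfold.sub_le_one (M := M) (by omega) (by omega) (by omega) hsum ?_ ?_ ?_ ?_
    ?_ ?_ ?_ ?_⟩, ?_⟩
  · exact (hval 0 (Nat.zero_le _)).trans h0
  · rw [hval M le_rfl]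
    exact hendM.1
  · rw [hval M le_rfl]
    exact hendM.2
  · intro x hx hxM
    lift x to ℕ using hx
    have h1 := hval (x + 1) (by omega)
    rw [Nat.cast_succ] at h1
    rw [hval x (by omega), h1]
    exact (hstep x (by omega)).2
  · intro x y hx hxy hy hyx
    lift x to ℕ using hx
    lift y to ℕ using by omega
    rw [hval x (by omega), hval y (by omega)]
    exact hwin x y (by omega) (by omega) (by omega)
  · intro x hx hxM hxp
    lift x to ℕ using hx
    rw [hval x (by omega)]
    exact hleft x (by omega) hxp
  · intro h2 x hx hxM hxp
    lift x to ℕ using hx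
    have := hright (by omega) x (by omega) (by omega)
    rw [hval x (by omega)]
    omega
  · intro h2 x hx hxM hxp
    lift x to ℕ using hx
    have := hright' (by omega) x (by omega) (by omega)
    rw [hval x (by omega)]
    omega
  · intro j hj
    rcases (by omega : j ≤ M ∨ (d % 2 = 1 ∧ j = s / 2 + (d + 1) / 2)) with h1 | ⟨h2, rfl⟩
    · rw [pathHeight_of_add_le (by omega), hval j h1]
    · rw [pathHeight_last h2, hlast]

theorem IsColumnFun.eq_of_pathHeight_eq {g' : ℤ → ℤ} (hg : IsColumnFun s d p g)
    (hg' : IsColumnFun s d p g') (hd : 0 < d) (hsd : Nat.Coprime s d)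
    (heq : ∀ j ≤ s / 2 + (d + 1) / 2, pathHeight s d g j = pathHeight s d g' j) : g = g' := by
  have hax := axis_cases s
  have hpar := odd_or_odd hsd
  refine hg.folded.eq_of_eqOn hg'.folded
    (M := ((s / 2 + (d + 1) / 2 - d % 2 : ℕ) : ℤ)) (by omega) (by omega) (by omega) ?_
  intro j hj hjM
  lift j to ℕ using hj
  have := heq j (by omega)
  rwa [pathHeight_of_add_le (by omega), pathHeight_of_add_le (by omega)] at this

theorem phi_eq (hsd : Nat.Coprime s d) (hμ : μ ∈ SC s d p) (hg : Represents s d μ g) :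
    phi s d μ = steps (pathHeight s d g) (s / 2 + (d + 1) / 2) := by
  have : height s d μ = pathHeight s d g := by
    funext j
    rw [height, pathHeight, hg.abacusFun_eq hsd hμ.1]
  rw [phi, this, steps]

end

end SelfConjCore

open SelfConjCore in
theorem theorem1p7 (s d p : ℕ) (hs : 0 < s) (hd : 0 < d) (hsd : Nat.Coprime s d) (hp : 2 ≤ p) :
    Set.BijOn (SelfConjCore.phi s d) (SelfConjCore.SC s d p)
      {P | P ∈ SelfConjCore.FreeMotzkin
            (((s / 2 + (d + 1) / 2 : ℕ) : ℤ)) (-(((d + 1) / 2 : ℕ) : ℤ)) ∧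
          SelfConjCore.Restricted s d p P} := by
  refine ⟨?_, ?_, ?_⟩
  · intro μ hμ
    obtain ⟨g, hg, hμg⟩ := exists_isColumnFun hs hsd (by omega) hμ
    have h := hg.isRestrictedHeight hd hsd hp
    rw [phi_eq hsd hμ hμg]
    exact (restricted_steps_iff hsd hp h.zero).2 h
  · intro μ hμ ν hν heq
    obtain ⟨g, hg, hμg⟩ := exists_isColumnFun hs hsd (by omega) hμ
    obtain ⟨g', hg', hνg⟩ := exists_isColumnFun hs hsd (by omega) hν
    rw [phi_eq hsd hμ hμg, phi_eq hsd hν hνg] at heq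
    have h := hg.isRestrictedHeight hd hsd hp
    have h' := hg'.isRestrictedHeight hd hsd hp
    obtain rfl := hg.eq_of_pathHeight_eq hg' hd hsd
      (steps_inj (h.zero.trans h'.zero.symm) heq)
    exact hμg.eq hsd hνg
  · rintro P ⟨hP, hR⟩
    obtain ⟨h, h0, hsteps⟩ := exists_steps_eq P hP.1
    have hlen : P.length = s / 2 + (d + 1) / 2 := by
      have h1 := hP.2
      rw [← hsteps, steps_sum, Prod.mk.injEq] at h1
      exact_mod_cast h1.1
    rw [hlen] at hsteps
    rw [← hsteps] at hP hR
    have hh := (restricted_steps_iff hsd hp h0).1 ⟨hP, hR⟩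
    obtain ⟨g, hg, hgh⟩ := hh.exists_isColumnFun hs hd hsd hp
    obtain ⟨μ, hμ, hμg⟩ := exists_mem_SC hs hsd hp hg
    refine ⟨μ, hμ, ?_⟩
    rw [phi_eq hsd hμ hμg, steps_congr hgh, hsteps]
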